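/- Let $(R,\mathfrak m)$ be a regular local ring (commutative, Noetherian, with identity) and let $\varphi\colon R\to R$ be a ring endomorphism of finite length, i.e. $\varphi$ is a local homomorphism and the ideal $\varphi(\mathfrak m)R$ is $\mathfrak m$-primary. Write $\varphi^n$ for the $n$-fold composition of $\varphi$ with itself; each $\varphi^n$ is again of finite length, and its length $\lambda(\varphi^n):=\ell_R\big(R/\varphi^n(\mathfrak m)R\big)$ is finite. The limit $$h_{\mathrm{alg}}(\varphi,R):=\lim_{n\to\infty}\frac{\log\lambda(\varphi^n)}{n}$$ exists in $\mathbb R$; put $q(\varphi):=\exp\big(h_{\mathrm{alg}}(\varphi,R)\big)$. Then the Hilbert–Kunz multiplicity of $R$ with respect to $\varphi$, $$e_{\mathrm{HK}}(\varphi,R):=\lim_{n\to\infty}\frac{\lambda(\varphi^n)}{q(\varphi)^n},$$ exists and equals $1$. -/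

import Mathlib

open Filter Topology

namespace FiniteLengthMap

/-- A homomorphism `f : (R, 𝔪) → (S, 𝔫)` of local rings is of finite length if it is local and the
extended ideal `f(𝔪)S` is `𝔫`-primary. -/
structure IsOfFiniteLength {R S : Type*} [CommRing R] [IsLocalRing R] [CommRing S] [IsLocalRing S]
    (f : R →+* S) : Prop where
  isLocalHom : IsLocalHom f
  isPrimary : ((IsLocalRing.maximalIdeal R).map f).IsPrimary
  radical_eq : ((IsLocalRing.maximalIdeal R).map f).radical = IsLocalRing.maximalIdeal S

/-- The length `λ(f) = ℓ_S(S / f(𝔪)S)` of `f`, a priori an extended natural number. -/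
noncomputable def length {R S : Type*} [CommRing R] [IsLocalRing R] [CommRing S]
    (f : R →+* S) : ℕ∞ :=
  Module.length S (S ⧸ (IsLocalRing.maximalIdeal R).map f)

/-- The real sequence `n ↦ λ(φⁿ)`; here `φ ^ n` is the `n`-fold composition of `φ` with itself. -/
noncomputable def lengthSeq {R : Type*} [CommRing R] [IsLocalRing R] (φ : R →+* R) (n : ℕ) : ℝ :=
  ((length (φ ^ n)).toNat : ℝ)

/-- The algebraic entropy `h_alg(φ, R) = lim (log λ(φⁿ)) / n`. -/
noncomputable def algEntropy {R : Type*} [CommRing R] [IsLocalRing R] (φ : R →+* R) : ℝ :=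
  limUnder atTop (fun n : ℕ => Real.log (lengthSeq φ n) / n)

/-- `q(φ) = exp (h_alg(φ, R))`. -/
noncomputable def q {R : Type*} [CommRing R] [IsLocalRing R] (φ : R →+* R) : ℝ :=
  Real.exp (algEntropy φ)

/-- The Hilbert–Kunz multiplicity `e_HK(φ, R) = lim λ(φⁿ) / q(φ)ⁿ`, meaningful when the limit
exists. -/
noncomputable def hilbertKunz {R : Type*} [CommRing R] [IsLocalRing R] (φ : R →+* R) : ℝ :=
  limUnder atTop (fun n : ℕ => lengthSeq φ n / q φ ^ n)

end FiniteLengthMap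

/-!
# Hilbert–Kunz multiplicity of an endomorphism of a regular local ring

The theorem holds because the length is multiplicative, `λ(φⁿ) = λ(φ)ⁿ`
(`FiniteLengthMap.IsOfFiniteLength.length_pow`): the entropy is then `log λ(φ)`, so `q(φ) = λ(φ)`
and the sequence defining the multiplicity is constantly `1`.

Multiplicativity follows from `ℓ(R ⧸ φ(I)R) = λ(φ) ℓ(R ⧸ I)` for `𝔪`-primary ideals `I`
(`IsRegularLocalRing.length_quotient_map`), applied to `I = φⁿ(𝔪)R`. This formula is a consequence
of the flatness of `φ`, but flatness can be bypassed. Without it, right exactness of the tensor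
product still gives `≤`, and equality for `I` implies equality for all `J ⊇ I`
(`IsLocalRing.length_quotient_map_eq_of_le`). Every `𝔪`-primary ideal contains `(x₁ᵏ, …, x_dᵏ)` for
some `k`, where `x₁, …, x_d` generate `𝔪` and `d = dim R`, so these ideals suffice. Both
`x₁, …, x_d` and `φ(x₁), …, φ(x_d)` are systems of parameters, hence regular sequences, and for a
regular sequence `y₁, …, y_d` the length of `R ⧸ (y₁ᵏ, …, y_dᵏ)` is `kᵈ` times that of
`R ⧸ (y₁, …, y_d)`.

That systems of parameters are regular sequences is the Cohen–Macaulay property of regular local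
rings (`IsRegularLocalRing.isWeaklyRegular_of_radical_eq`). A regular local ring has depth at least
`d`, submodules of a module of depth at least `n` have dimension at least `n`, and the depth drops
by at most one modulo a regular element.
-/

open IsLocalRing RingTheory.Sequence TensorProduct

universe u

/-! ### Regular local rings are domains of maximal depth -/

/-- An element of `𝔪` outside `𝔪²` can replace some member of any finite generating set of `𝔪`. -/
theorem IsLocalRing.exists_span_insert_erase_eq_maximalIdeal {R : Type*} [CommRing R]
    [IsLocalRing R] [DecidableEq R] {s : Finset R} (hs : Ideal.span (s : Set R) = maximalIdeal R)
    {x : R} (hx : x ∈ maximalIdeal R) (hx2 : x ∉ maximalIdeal R ^ 2) :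
    ∃ j ∈ s, Ideal.span (insert x (s.erase j : Set R)) = maximalIdeal R := by
  have hsub : (s : Set R) ⊆ maximalIdeal R := hs ▸ Ideal.subset_span
  obtain ⟨a, -, ha⟩ := Submodule.mem_span_finset.mp (hs.symm ▸ hx : x ∈ Ideal.span (s : Set R))
  obtain ⟨j, hj, hu⟩ : ∃ j ∈ s, IsUnit (a j) := by
    by_contra! h
    refine hx2 (ha ▸ Ideal.sum_mem _ fun i hi ↦ ?_)
    rw [pow_two]
    exact Ideal.mul_mem_mul (h i hi) (hsub hi)
  refine ⟨j, hj, le_antisymm (Ideal.span_le.mpr ?_) ?_⟩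
  · rintro y (rfl | hy)
    · exact hx
    · exact hsub (Finset.mem_of_mem_erase hy)
  · -- Some coefficient of `x` in terms of `s` is a unit, so `j` is recovered from the rest.
    rw [← hs, Ideal.span_le]
    intro y hy
    by_cases hyj : y = j
    · subst hyj
      refine (Ideal.unit_mul_mem_iff_mem _ hu).mp ?_
      rw [← Finset.add_sum_erase _ _ hj] at ha
      rw [← smul_eq_mul, eq_sub_of_add_eq ha]
      refine sub_mem (Ideal.subset_span (Set.mem_insert _ _)) (Ideal.sum_mem _ fun i hi ↦ ?_)
      exact Ideal.mul_mem_left _ _ (Ideal.subset_span (Set.mem_insert_of_mem _ hi))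
    · exact Ideal.subset_span (Set.mem_insert_of_mem _ (Finset.mem_erase.mpr ⟨hyj, hy⟩))

theorem IsRegularLocalRing.quotient_of_notMem_sq {R : Type*} [CommRing R] [IsRegularLocalRing R]
    {n : ℕ} (hn : ringKrullDim R = (n + 1 : ℕ)) {x : R} (hx : x ∈ maximalIdeal R)
    (hx2 : x ∉ maximalIdeal R ^ 2) :
    IsRegularLocalRing (R ⧸ Ideal.span {x}) ∧ ringKrullDim (R ⧸ Ideal.span {x}) = n := by
  classical
  have hne : Ideal.span {x} ≠ (⊤ : Ideal R) := by
    rw [Ne, Ideal.span_singleton_eq_top]; exact hx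
  have : Nontrivial (R ⧸ Ideal.span {x}) := Ideal.Quotient.nontrivial_iff.mpr hne
  have : IsLocalRing (R ⧸ Ideal.span {x}) :=
    .of_surjective' (Ideal.Quotient.mk _) Ideal.Quotient.mk_surjective
  obtain ⟨s, hcard, hs⟩ :=
    Submodule.FG.exists_span_finset_card_eq_spanFinrank (maximalIdeal R).fg_of_isNoetherianRing
  obtain ⟨j, hj, hspan⟩ := exists_span_insert_erase_eq_maximalIdeal hs hx hx2
  have hcard' : s.card = n + 1 := by
    have := IsRegularLocalRing.spanFinrank_maximalIdeal (R := R)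
    rw [hn, ← hcard] at this
    exact_mod_cast this
  have hmax : maximalIdeal (R ⧸ Ideal.span {x}) =
      Ideal.span ((s.erase j).image (Ideal.Quotient.mk (Ideal.span {x})) : Set _) := by
    have h1 : (maximalIdeal R).map (Ideal.Quotient.mk (Ideal.span {x})) =
        maximalIdeal (R ⧸ Ideal.span {x}) := by
      refine (IsLocalRing.eq_maximalIdeal ?_)
      exact Ideal.IsMaximal.map_of_surjective_of_ker_le Ideal.Quotient.mk_surjective (by
        rw [Ideal.mk_ker]; exact (Ideal.span_singleton_le_iff_mem _).mpr hx)
    rw [← h1, ← hspan, Ideal.map_span, Set.image_insert_eq, Finset.coe_image,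
      Ideal.Quotient.eq_zero_iff_mem.mpr (Ideal.mem_span_singleton_self x)]
    exact Ideal.span_insert_zero
  have hfin : (maximalIdeal (R ⧸ Ideal.span {x})).spanFinrank ≤ n := by
    rw [hmax]
    refine (Submodule.spanFinrank_span_le_ncard_of_finite (Finset.finite_toSet _)).trans ?_
    rw [Set.ncard_coe_finset]
    refine Finset.card_image_le.trans ?_
    rw [Finset.card_erase_of_mem hj, hcard']; simp
  have hdim : (n : WithBot ℕ∞) ≤ ringKrullDim (R ⧸ Ideal.span {x}) := by
    have h := ringKrullDim_le_ringKrullDim_quotient_add_card (R := R) {x} (by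
      rw [IsLocalRing.ringJacobson_eq_maximalIdeal]; simpa using hx)
    rw [hn] at h
    rw [Finset.card_singleton, Finset.coe_singleton, Nat.cast_add] at h
    exact ENat.WithBot.add_le_add_natCast_right_iff.mp h
  have hreg : IsRegularLocalRing (R ⧸ Ideal.span {x}) :=
    .of_spanFinrank_maximalIdeal_le _ ((by exact_mod_cast hfin : _ ≤ (n : WithBot ℕ∞)).trans hdim)
  refine ⟨hreg, le_antisymm ?_ hdim⟩
  rw [← IsRegularLocalRing.spanFinrank_maximalIdeal]
  exact_mod_cast hfin

/-- If `(x)` is prime and contains a minimal prime `P ∌ x`, then `P = xP`, so `P = 0` by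
Nakayama. -/
theorem IsLocalRing.isDomain_of_isPrime_span_singleton {R : Type*} [CommRing R] [IsLocalRing R]
    [IsNoetherianRing R] {x : R} (hx : x ∈ maximalIdeal R) (hp : (Ideal.span {x}).IsPrime)
    (hmin : ∀ p ∈ minimalPrimes R, x ∉ p) : IsDomain R := by
  obtain ⟨P, hP, hle⟩ := Ideal.exists_minimalPrimes_le (bot_le (a := Ideal.span {x}))
  have hPprime : P.IsPrime := hP.isPrime
  have key : P = ⊥ := by
    refine Submodule.eq_bot_of_le_smul_of_le_jacobson_bot (maximalIdeal R) P
      P.fg_of_isNoetherianRing (fun a ha ↦ ?_) (maximalIdeal_le_jacobson _)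
    obtain ⟨b, rfl⟩ := Ideal.mem_span_singleton'.mp (hle ha)
    rw [mul_comm]
    exact Submodule.smul_mem_smul hx ((hPprime.mem_or_mem ha).resolve_right (hmin P hP))
  subst key
  exact IsDomain.of_bot_isPrime R

/-- A regular local ring is a domain, and its depth is at least its dimension. The two claims are
proved together: that `R ⧸ (x)` is a domain shows that `R` is one, hence that `x` is regular. -/
theorem IsRegularLocalRing.isDomain_and_exists_isRegular (n : ℕ) (R : Type u) [CommRing R]
    [IsRegularLocalRing R] (hn : ringKrullDim R = n) :
    IsDomain R ∧ ∃ rs : List R, rs.length = n ∧ (∀ r ∈ rs, r ∈ maximalIdeal R) ∧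
      IsRegular R rs := by
  induction n generalizing R with
  | zero =>
    have h0 : (maximalIdeal R).spanFinrank = 0 := by
      have := IsRegularLocalRing.spanFinrank_maximalIdeal (R := R)
      rw [hn] at this
      exact_mod_cast this
    rw [Submodule.spanFinrank_eq_zero_iff_eq_bot (maximalIdeal R).fg_of_isNoetherianRing,
      ← IsLocalRing.isField_iff_maximalIdeal_eq] at h0
    exact ⟨h0.isDomain, [], rfl, by simp, .nil R R⟩
  | succ n ih =>
    -- Prime avoidance tolerates the one ideal `𝔪²` that need not be prime.
    obtain ⟨x, hx, hx2, hmin⟩ : ∃ x ∈ maximalIdeal R, x ∉ maximalIdeal R ^ 2 ∧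
        ∀ p ∈ minimalPrimes R, x ∉ p := by
      by_contra! h
      have hsub : ((maximalIdeal R : Ideal R) : Set R) ⊆
          ⋃ I ∈ insert (maximalIdeal R ^ 2) (minimalPrimes R), (I : Set R) := by
        intro x hx
        by_cases hx2 : x ∈ maximalIdeal R ^ 2
        · exact Set.mem_biUnion (Set.mem_insert _ _) hx2
        · obtain ⟨p, hp, hxp⟩ := h x hx hx2
          exact Set.mem_biUnion (Set.mem_insert_of_mem _ hp) hxp
      obtain ⟨I, hI, hle⟩ := (Ideal.subset_union_prime_finite
        ((minimalPrimes.finite_of_isNoetherianRing R).insert _) (f := id)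
        (maximalIdeal R ^ 2) (maximalIdeal R ^ 2)
        (fun i hi hne _ ↦ ((Set.mem_insert_iff.mp hi).resolve_left hne).isPrime)).mp hsub
      rcases hI with rfl | hI
      · exact (maximalIdeal_sq_lt_of_ringKrullDim_ne_zero (R := R)
          (by rw [hn]; exact_mod_cast n.succ_ne_zero)).not_ge hle
      · have hIp : I.IsPrime := hI.isPrime
        have heq : I = maximalIdeal R := le_antisymm (le_maximalIdeal hIp.ne_top) hle
        rw [heq, ← Ideal.height_eq_zero_iff] at hI
        have h0 := IsLocalRing.maximalIdeal_height_eq_ringKrullDim (R := R)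
        rw [hI, hn] at h0
        exact n.succ_ne_zero (by exact_mod_cast h0.symm)
    obtain ⟨hreg, hdim⟩ := IsRegularLocalRing.quotient_of_notMem_sq hn hx hx2
    obtain ⟨hdom, rs, hlen, hmem, hrs⟩ := ih _ hdim
    have hR : IsDomain R := isDomain_of_isPrime_span_singleton hx
      ((Ideal.Quotient.isDomain_iff_prime _).mp hdom) hmin
    have hx0 : x ≠ 0 := by rintro rfl; exact hx2 (zero_mem _)
    refine ⟨hR, ?_⟩
    obtain ⟨ts, rfl⟩ : ∃ ts : List R, ts.map (Ideal.Quotient.mk (Ideal.span {x})) = rs :=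
      List.map_surjective_iff.mpr Ideal.Quotient.mk_surjective rs
    have hts : ∀ r ∈ x :: ts, r ∈ maximalIdeal R := by
      intro r hr
      rcases List.mem_cons.mp hr with rfl | hr
      · exact hx
      · have := hmem _ (List.mem_map_of_mem hr)
        intro hu
        exact this (hu.map _)
    refine ⟨x :: ts, by simpa using hlen, hts, ?_⟩
    refine IsRegular.of_isWeaklyRegular_of_mem_maximalIdeal R hts ?_
    refine .cons (IsSMulRegular.of_ne_zero hx0) ?_
    have e : QuotSMulTop x R ≃ₗ[R] R ⧸ Ideal.span {x} :=
      Submodule.quotEquivOfEq _ _ (by rw [← Submodule.ideal_span_singleton_smul]; simp)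
    exact (e.isWeaklyRegular_congr ts).mpr
      ((isWeaklyRegular_map_algebraMap_iff (R ⧸ Ideal.span {x}) (R ⧸ Ideal.span {x}) ts).mp
        hrs.toIsWeaklyRegular)

/-! ### Depth and systems of parameters -/

open Pointwise in
/-- If `M ⧸ N` has no `x`-torsion, then `N ⧸ xN` embeds into `M ⧸ xM`. -/
theorem QuotSMulTop.map_subtype_injective {R M : Type*} [CommRing R] [AddCommGroup M] [Module R M]
    {N : Submodule R M} {x : R} (h : ∀ m, x • m ∈ N → m ∈ N) :
    Function.Injective (QuotSMulTop.map x N.subtype) := by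
  rw [← LinearMap.ker_eq_bot, LinearMap.ker_eq_bot']
  intro a ha
  obtain ⟨a, rfl⟩ := Submodule.Quotient.mk_surjective _ a
  rw [QuotSMulTop.map_apply_mk, Submodule.Quotient.mk_eq_zero,
    Submodule.mem_smul_pointwise_iff_exists] at ha
  obtain ⟨m, -, hm⟩ := ha
  rw [Submodule.Quotient.mk_eq_zero, Submodule.mem_smul_pointwise_iff_exists]
  refine ⟨⟨m, h m ?_⟩, trivial, Subtype.ext hm⟩
  rw [hm]
  exact a.2

/-- The `x`-saturation of `N` in a Noetherian module, together with a power of `x` that maps it back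
into `N`. -/
theorem Submodule.exists_le_saturated {R M : Type*} [CommRing R] [AddCommGroup M] [Module R M]
    [IsNoetherian R M] (N : Submodule R M) (x : R) :
    ∃ N' : Submodule R M, N ≤ N' ∧ (∀ m, x • m ∈ N' → m ∈ N') ∧
      ∃ k : ℕ, ∀ m ∈ N', x ^ k • m ∈ N := by
  let f : ℕ →o Submodule R M :=
    { toFun k := N.comap (LinearMap.lsmul R M (x ^ k))
      monotone' := by
        refine monotone_nat_of_le_succ fun k m hm ↦ ?_
        have : x • x ^ k • m ∈ N := N.smul_mem x hm
        simpa [smul_smul, pow_succ'] using this }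
  obtain ⟨k, hk⟩ := monotone_stabilizes_iff_noetherian.mpr ‹_› f
  refine ⟨f k, fun m hm ↦ N.smul_mem _ hm, fun m hm ↦ ?_, k, fun m hm ↦ hm⟩
  rw [hk (k + 1) k.le_succ]
  have : x ^ k • x • m ∈ N := hm
  simpa [f, smul_smul, pow_succ] using this

/-- Nonzero submodules of a module of depth at least `n` have dimension at least `n`. For a regular
element `x`, the submodule `N` may be replaced by its `x`-saturation `N'`, which embeds into `N`;
then `N' ⧸ xN'` is a nonzero submodule of `M ⧸ xM` of dimension one less. -/
theorem RingTheory.Sequence.IsRegular.length_le_supportDim_of_injective {R : Type*} [CommRing R]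
    [IsLocalRing R] [IsNoetherianRing R] {M N : Type u} [AddCommGroup M] [Module R M]
    [Module.Finite R M] [AddCommGroup N] [Module R N] [Nontrivial N] {rs : List R}
    (hrs : IsRegular M rs) (f : N →ₗ[R] M) (hf : Function.Injective f) :
    (rs.length : WithBot ℕ∞) ≤ Module.supportDim R N := by
  induction rs generalizing M N with
  | nil =>
    have : Nonempty (Module.support R N) := Module.nonempty_support_of_nontrivial.to_subtype
    simpa [Module.supportDim] using Order.krullDim_nonneg (α := Module.support R N)
  | cons x rs ih =>
    have hx : x ∈ maximalIdeal R := by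
      simpa using fun hu ↦ hrs.2 (by simp [Ideal.span_singleton_eq_top.mpr hu])
    obtain ⟨hreg, hrs'⟩ := (isRegular_cons_iff M x rs).mp hrs
    obtain ⟨N', hle, hsat, k, hk⟩ := Submodule.exists_le_saturated (LinearMap.range f) x
    have hN' : Nontrivial N' := by
      have := (LinearEquiv.ofInjective f hf).symm.toEquiv.nontrivial
      exact (Submodule.inclusion_injective hle).nontrivial
    have := nontrivial_quotSMulTop_of_mem_maximalIdeal N' hx
    have h1 := ih hrs' (QuotSMulTop.map x N'.subtype) (QuotSMulTop.map_subtype_injective hsat)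
    have hreg' : IsSMulRegular N' x := hreg.of_injective N'.subtype N'.subtype_injective
    have h2 := Module.supportDim_quotSMulTop_succ_eq_supportDim hreg' hx
    let g : N' →ₗ[R] LinearMap.range f :=
      LinearMap.codRestrict _ ((LinearMap.lsmul R M (x ^ k)).comp N'.subtype) fun m ↦ hk m m.2
    have hg : Function.Injective g := by
      refine fun a b hab ↦ Subtype.ext (hreg.pow k ?_)
      exact congrArg Subtype.val hab
    have h3 := Module.supportDim_le_of_injective g hg
    rw [Module.supportDim_eq_of_equiv (LinearEquiv.ofInjective f hf), List.length_cons,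
      Nat.cast_add]
    refine le_trans ?_ h3
    rw [← h2]
    gcongr
    simp

/-- Dividing by any regular element lowers the depth by at most one, by Rees's description of depth
through `Ext` and the long exact sequence of `0 → M → M → M ⧸ yM → 0`. -/
theorem RingTheory.Sequence.exists_isRegular_quotSMulTop {R : Type u} [CommRing R] [IsLocalRing R]
    [IsNoetherianRing R] {M : Type u} [AddCommGroup M] [Module R M] [Module.Finite R M]
    {rs : List R} (hmem : ∀ r ∈ rs, r ∈ maximalIdeal R) (hrs : IsRegular M rs) {n : ℕ}
    (hn : rs.length = n + 1) {y : R} (hy : y ∈ maximalIdeal R) (hreg : IsSMulRegular M y) :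
    ∃ ts : List R, ts.length = n ∧ (∀ r ∈ ts, r ∈ maximalIdeal R) ∧
      IsRegular (QuotSMulTop y M) ts := by
  have := hrs.nontrivial
  have hlt (L : Type u) [AddCommGroup L] [Module R L] [Module.Finite R L] [Nontrivial L] :
      maximalIdeal R • (⊤ : Submodule R L) < ⊤ :=
    (Submodule.top_ne_ideal_smul_of_le_jacobson_annihilator
      (maximalIdeal_le_jacobson _)).symm.lt_top
  have hnt : Nontrivial (QuotSMulTop y M) := nontrivial_quotSMulTop_of_mem_maximalIdeal M hy
  have h1 : ∀ i < n + 1, Subsingleton (CategoryTheory.Abelian.Ext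
      (ModuleCat.of R (Shrink.{u} (R ⧸ maximalIdeal R))) (ModuleCat.of R M) i) := by
    refine ((ModuleCat.exists_isRegular_tfae (maximalIdeal R) (n + 1) (ModuleCat.of R M)
      (hlt M)).out 3 1).mp ?_
    exact ⟨rs, hn, hmem, hrs⟩
  refine ((ModuleCat.exists_isRegular_tfae (maximalIdeal R) n (ModuleCat.of R (QuotSMulTop y M))
    (hlt (QuotSMulTop y M))).out 1 3).mp fun i hi ↦ ?_
  have z1 := AddCommGrpCat.isZero_of_iff_subsingleton.mpr (h1 i (by omega))
  have z2 := AddCommGrpCat.isZero_of_iff_subsingleton.mpr (h1 (i + 1) (by omega))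
  exact AddCommGrpCat.subsingleton_of_isZero <|
    CategoryTheory.ShortComplex.Exact.isZero_of_both_zeros
      ((CategoryTheory.Abelian.Ext.covariant_sequence_exact₃' _
        (IsSMulRegular.smulShortComplex_shortExact (M := ModuleCat.of R M) hreg)) i (i + 1) rfl)
      (z1.eq_zero_of_src _) (z2.eq_zero_of_tgt _)

theorem Module.supportDim_le_supportDim_quotient_ofList_add_length {R : Type*} [CommRing R]
    [IsLocalRing R] [IsNoetherianRing R] {M : Type*} [AddCommGroup M] [Module R M]
    [Module.Finite R M] {ys : List R} (hys : ∀ y ∈ ys, y ∈ maximalIdeal R) :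
    Module.supportDim R M ≤
      Module.supportDim R (M ⧸ Ideal.ofList ys • (⊤ : Submodule R M)) + ys.length := by
  induction ys generalizing M with
  | nil =>
    simpa using (Module.supportDim_eq_of_equiv
      (Submodule.quotEquivOfEqBot (Ideal.ofList [] • (⊤ : Submodule R M)) (by simp))).ge
  | cons y ys ih =>
    have h1 := Module.supportDim_le_supportDim_quotSMulTop_succ (M := M)
      (hys y List.mem_cons_self)
    have h2 := ih (M := QuotSMulTop y M) fun z hz ↦ hys z (List.mem_cons_of_mem _ hz)
    rw [← Module.supportDim_eq_of_equiv
      (Submodule.quotOfListConsSMulTopEquivQuotSMulTopInner M y ys)] at h2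
    refine h1.trans ((add_le_add_left h2 1).trans ?_)
    rw [List.length_cons, Nat.cast_add, Nat.cast_one, add_assoc]

/-- In a module with an `M`-regular sequence of length `d`, any `d` elements of `𝔪` that cut the
support down to dimension at most zero form a weakly regular sequence. -/
theorem RingTheory.Sequence.isWeaklyRegular_of_supportDim_quotient_le_zero {R : Type u}
    [CommRing R] [IsLocalRing R] [IsNoetherianRing R] {M : Type u} [AddCommGroup M] [Module R M]
    [Module.Finite R M] {rs ys : List R} (hmem : ∀ r ∈ rs, r ∈ maximalIdeal R)
    (hrs : IsRegular M rs) (hys : ∀ y ∈ ys, y ∈ maximalIdeal R) (hlen : ys.length = rs.length)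
    (hdim : Module.supportDim R (M ⧸ Ideal.ofList ys • (⊤ : Submodule R M)) ≤ 0) :
    IsWeaklyRegular M ys := by
  induction ys generalizing M rs with
  | nil => exact .nil R M
  | cons y ys ih =>
    have hys' : ∀ z ∈ ys, z ∈ maximalIdeal R := fun z hz ↦ hys z (List.mem_cons_of_mem _ hz)
    rw [Module.supportDim_eq_of_equiv
      (Submodule.quotOfListConsSMulTopEquivQuotSMulTopInner M y ys)] at hdim
    have hy : y ∈ maximalIdeal R := hys y List.mem_cons_self
    have hreg : IsSMulRegular M y := by
      rw [isSMulRegular_iff_torsionBy_eq_bot]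
      by_contra hne
      -- The `y`-torsion is supported on `Supp (M ⧸ yM)`, whose dimension is less than the depth.
      have : Nontrivial (Submodule.torsionBy R M y) := Submodule.nontrivial_iff_ne_bot.mpr hne
      have h1 := hrs.length_le_supportDim_of_injective (Submodule.torsionBy R M y).subtype
        (Submodule.subtype_injective _)
      have h2 : Module.supportDim R (Submodule.torsionBy R M y) ≤
          Module.supportDim R (QuotSMulTop y M) := by
        refine Order.krullDim_le_of_strictMono (fun p ↦ ⟨p.1, ?_⟩) fun _ _ h ↦ h
        rw [Module.support_quotSMulTop]
        refine ⟨Module.support_subset_of_injective _ (Submodule.subtype_injective _) p.2, ?_⟩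
        rw [PrimeSpectrum.mem_zeroLocus, Set.singleton_subset_iff]
        refine Module.mem_support_iff_of_finite.mp p.2 (Module.mem_annihilator.mpr fun m ↦ ?_)
        exact Subtype.ext m.2
      have h3 := Module.supportDim_le_supportDim_quotient_ofList_add_length
        (M := QuotSMulTop y M) hys'
      have h4 := (h1.trans (h2.trans h3)).trans (add_le_add_left hdim _)
      rw [← hlen, zero_add] at h4
      have h5 : (y :: ys).length ≤ ys.length := by exact_mod_cast h4
      simp at h5
    obtain ⟨ts, htl, htm, hts⟩ := exists_isRegular_quotSMulTop hmem hrs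
      (n := ys.length) (by simpa using hlen.symm) hy hreg
    exact .cons hreg (ih htm hts hys' htl.symm hdim)

/-! ### Powers of regular sequences -/

open Pointwise in
theorem IsSMulRegular.length_quotSMulTop_pow {R M : Type*} [CommRing R] [AddCommGroup M]
    [Module R M] {r : R} (hr : IsSMulRegular M r) (n : ℕ) :
    Module.length R (QuotSMulTop (r ^ n) M) = n * Module.length R (QuotSMulTop r M) := by
  induction n with
  | zero =>
    have : Subsingleton (QuotSMulTop (r ^ 0) M) := by
      rw [pow_zero, Submodule.Quotient.subsingleton_iff, one_smul]
    simp [Module.length_eq_zero]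
  | succ n ih =>
    have hle : r ^ (n + 1) • (⊤ : Submodule R M) ≤ r • (⊤ : Submodule R M) := by
      rw [pow_succ', mul_smul]
      exact smul_mono_right r le_top
    have hmap : r ^ n • (⊤ : Submodule R M) ≤
        (r ^ (n + 1) • (⊤ : Submodule R M)).comap (LinearMap.lsmul R M r) := by
      intro m hm
      obtain ⟨a, -, rfl⟩ := (Submodule.mem_smul_pointwise_iff_exists _ _ _).mp hm
      refine (Submodule.mem_smul_pointwise_iff_exists _ _ _).mpr ⟨a, trivial, ?_⟩
      simp [pow_succ, mul_smul]
    -- `0 → M ⧸ rⁿM → M ⧸ rⁿ⁺¹M → M ⧸ rM → 0`, the first map being multiplication by `r`.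
    rw [Module.length_eq_add_of_exact (Submodule.mapQ _ _ (LinearMap.lsmul R M r) hmap)
      (Submodule.factor hle) ?_ (Submodule.factor_surjective hle) ?_, ih]
    · push_cast; ring
    · rw [← LinearMap.ker_eq_bot, LinearMap.ker_eq_bot']
      intro a ha
      obtain ⟨a, rfl⟩ := Submodule.Quotient.mk_surjective _ a
      rw [Submodule.mapQ_apply, Submodule.Quotient.mk_eq_zero,
        Submodule.mem_smul_pointwise_iff_exists] at ha
      obtain ⟨b, -, hb⟩ := ha
      rw [Submodule.Quotient.mk_eq_zero, Submodule.mem_smul_pointwise_iff_exists]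
      refine ⟨b, trivial, hr ?_⟩
      simpa [pow_succ', mul_smul] using hb
    · intro a
      obtain ⟨a, rfl⟩ := Submodule.Quotient.mk_surjective _ a
      change Submodule.Quotient.mk a = 0 ↔ _
      rw [Submodule.Quotient.mk_eq_zero, Submodule.mem_smul_pointwise_iff_exists]
      constructor
      · rintro ⟨b, -, rfl⟩
        exact ⟨Submodule.Quotient.mk b, rfl⟩
      · rintro ⟨b, hb⟩
        obtain ⟨b, rfl⟩ := Submodule.Quotient.mk_surjective _ b
        rw [Submodule.mapQ_apply, Submodule.Quotient.eq] at hb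
        obtain ⟨c, -, hc⟩ := (Submodule.mem_smul_pointwise_iff_exists _ _ _).mp (hle hb)
        refine ⟨b - c, trivial, ?_⟩
        rw [smul_sub, hc]
        simp

/-- The first member can be moved to the end, where raising it to a power is harmless, and back. -/
theorem RingTheory.Sequence.IsWeaklyRegular.pow_cons {R M : Type*} [CommRing R] [IsLocalRing R]
    [AddCommGroup M] [Module R M] [IsNoetherian R M] {r : R} {rs : List R}
    (h : IsWeaklyRegular M (r :: rs)) (hmem : ∀ s ∈ r :: rs, s ∈ maximalIdeal R) {n : ℕ}
    (hn : n ≠ 0) : IsWeaklyRegular M (r ^ n :: rs) := by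
  have h1 := isWeaklyRegular_of_perm_of_subset_maximalIdeal h (List.perm_append_singleton r rs).symm
    hmem
  rw [isWeaklyRegular_append_iff, isWeaklyRegular_singleton_iff] at h1
  have h2 : IsWeaklyRegular M (rs ++ [r ^ n]) := by
    rw [isWeaklyRegular_append_iff, isWeaklyRegular_singleton_iff]
    exact ⟨h1.1, h1.2.pow n⟩
  refine isWeaklyRegular_of_perm_of_subset_maximalIdeal h2 (List.perm_append_singleton _ rs) ?_
  intro s hs
  rcases List.mem_append.mp hs with hs | hs
  · exact hmem s (List.mem_cons_of_mem _ hs)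
  · rw [List.mem_singleton.mp hs]
    exact Ideal.pow_mem_of_mem _ (hmem r List.mem_cons_self) n (Nat.pos_of_ne_zero hn)

/-- Raising a weakly regular sequence of length `d` to `n`-th powers multiplies the length of the
quotient by `n ^ d`. -/
theorem RingTheory.Sequence.IsWeaklyRegular.length_quotient_ofList_map_pow {R M : Type*}
    [CommRing R] [IsLocalRing R] [AddCommGroup M] [Module R M] [IsNoetherian R M] {rs : List R}
    (h : IsWeaklyRegular M rs) (hmem : ∀ s ∈ rs, s ∈ maximalIdeal R) {n : ℕ} (hn : n ≠ 0) :
    Module.length R (M ⧸ Ideal.ofList (rs.map (· ^ n)) • (⊤ : Submodule R M)) =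
      n ^ rs.length * Module.length R (M ⧸ Ideal.ofList rs • (⊤ : Submodule R M)) := by
  induction rs generalizing M with
  | nil => rw [List.length_nil, pow_zero, one_mul, List.map_nil]
  | cons r rs ih =>
    have hreg := isWeaklyRegular_of_perm_of_subset_maximalIdeal h
      (List.perm_append_singleton r rs).symm hmem
    rw [isWeaklyRegular_append_iff, isWeaklyRegular_singleton_iff] at hreg
    have h1 := ((isWeaklyRegular_cons_iff M _ _).mp (h.pow_cons hmem hn)).2
    rw [List.map_cons,
      (Submodule.quotOfListConsSMulTopEquivQuotSMulTopInner M (r ^ n) _).length_eq,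
      ih h1 fun s hs ↦ hmem s (List.mem_cons_of_mem _ hs),
      ← (Submodule.quotOfListConsSMulTopEquivQuotSMulTopInner M (r ^ n) _).length_eq,
      (Submodule.quotOfListConsSMulTopEquivQuotSMulTopOuter M (r ^ n) _).length_eq,
      hreg.2.length_quotSMulTop_pow,
      (Submodule.quotOfListConsSMulTopEquivQuotSMulTopOuter M r _).length_eq, List.length_cons,
      pow_succ, mul_assoc]

/-! ### Length and base change -/

theorem Module.length_le_add_of_exact {R N M P : Type*} [Ring R] [AddCommGroup N] [Module R N]
    [AddCommGroup M] [Module R M] [AddCommGroup P] [Module R P] (f : N →ₗ[R] M) (g : M →ₗ[R] P)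
    (hg : Function.Surjective g) (h : Function.Exact f g) :
    Module.length R M ≤ Module.length R N + Module.length R P := by
  rw [Module.length_eq_add_of_exact (LinearMap.range f).subtype g (Submodule.subtype_injective _)
    hg (by rw [LinearMap.exact_iff, Submodule.range_subtype]; exact h.linearMap_ker_eq)]
  gcongr
  exact Module.length_le_of_surjective f.rangeRestrict f.surjective_rangeRestrict

section BaseChange

variable {A B : Type*} [CommRing A] [IsLocalRing A] [CommRing B] [Algebra A B]

/-- Right exactness of the tensor product bounds the length of a base change from above. No flatness
is assumed; compare `IsLocalRing.length_baseChange`. -/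
theorem IsLocalRing.length_baseChange_le {M : Type*} [AddCommGroup M] [Module A M]
    (hM : IsFiniteLength A M) :
    Module.length B (B ⊗[A] M) ≤
      Module.length B (B ⧸ (maximalIdeal A).map (algebraMap A B)) * Module.length A M := by
  induction hM with
  | of_subsingleton => simp [Module.length_eq_zero]
  | @of_simple_quotient M _ _ N hN _ ih =>
    obtain ⟨m, hm, ⟨e⟩⟩ := isSimpleModule_iff_quot_maximal.mp hN
    obtain rfl := eq_maximalIdeal hm
    have h1 := Module.length_le_add_of_exact (N.subtype.baseChange B) (N.mkQ.baseChange B)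
      (LinearMap.lTensor_surjective B N.mkQ_surjective)
      (lTensor_exact B (LinearMap.exact_subtype_mkQ N) N.mkQ_surjective)
    rw [(e.baseChange A B _ _).length_eq,
      ← (Algebra.TensorProduct.quotIdealMapEquivTensorQuot B
        (maximalIdeal A)).toLinearEquiv.length_eq] at h1
    rw [Module.length_eq_add_of_exact N.subtype N.mkQ N.subtype_injective N.mkQ_surjective
      (LinearMap.exact_subtype_mkQ N), Module.length_eq_one_iff.mpr hN, mul_add, mul_one]
    exact h1.trans (by gcongr)

/-- Equality in `IsLocalRing.length_baseChange_le` passes to quotients: an excess on the kernel is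
impossible, so there is no room for a deficit on the quotient. -/
theorem IsLocalRing.length_baseChange_eq_of_surjective {M P : Type*} [AddCommGroup M] [Module A M]
    [AddCommGroup P] [Module A P] (hM : IsFiniteLength A M)
    (hB : Module.length B (B ⧸ (maximalIdeal A).map (algebraMap A B)) ≠ ⊤)
    (h : Module.length B (B ⊗[A] M) =
      Module.length B (B ⧸ (maximalIdeal A).map (algebraMap A B)) * Module.length A M)
    (g : M →ₗ[A] P) (hg : Function.Surjective g) :
    Module.length B (B ⊗[A] P) =
      Module.length B (B ⧸ (maximalIdeal A).map (algebraMap A B)) * Module.length A P := by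
  have hadd := Module.length_eq_add_of_exact (LinearMap.ker g).subtype g
    (Submodule.subtype_injective _) hg g.exact_subtype_ker_map
  have hM' := Module.length_ne_top_iff.mpr hM
  rw [hadd] at hM'
  have hK := (WithTop.add_ne_top.mp hM').1
  have hP := (WithTop.add_ne_top.mp hM').2
  refine le_antisymm (length_baseChange_le (Module.length_ne_top_iff.mp hP)) ?_
  have h1 := Module.length_le_add_of_exact ((LinearMap.ker g).subtype.baseChange B)
    (g.baseChange B) (LinearMap.lTensor_surjective B hg)
    (lTensor_exact B g.exact_subtype_ker_map hg)
  rw [h, hadd, mul_add] at h1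
  exact (ENat.add_le_add_iff_left (WithTop.mul_ne_top hB hK)).mp
    (h1.trans (add_le_add_left (length_baseChange_le (Module.length_ne_top_iff.mp hK)) _))

end BaseChange

/-- `IsLocalRing.length_baseChange_eq_of_surjective` for the surjection `R ⧸ I → R ⧸ J`. -/
theorem IsLocalRing.length_quotient_map_eq_of_le {R S : Type*} [CommRing R] [IsLocalRing R]
    [CommRing S] (f : R →+* S) {I J : Ideal R} (hIJ : I ≤ J)
    (hf : Module.length S (S ⧸ (maximalIdeal R).map f) ≠ ⊤) (hI : Module.length R (R ⧸ I) ≠ ⊤)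
    (h : Module.length S (S ⧸ I.map f) =
      Module.length S (S ⧸ (maximalIdeal R).map f) * Module.length R (R ⧸ I)) :
    Module.length S (S ⧸ J.map f) =
      Module.length S (S ⧸ (maximalIdeal R).map f) * Module.length R (R ⧸ J) := by
  algebraize [f]
  have key (K : Ideal R) : Module.length S (S ⧸ K.map f) = Module.length S (S ⊗[R] (R ⧸ K)) :=
    (Algebra.TensorProduct.quotIdealMapEquivTensorQuot S K).toLinearEquiv.length_eq
  rw [key J]
  rw [key I] at h
  exact length_baseChange_eq_of_surjective (Module.length_ne_top_iff.mp hI) hf h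
    (Submodule.factor hIJ) (Submodule.factor_surjective hIJ)

/-! ### Lengths of quotients of regular local rings -/

theorem IsLocalRing.length_quotient_ne_top_of_radical_eq {R : Type*} [CommRing R] [IsLocalRing R]
    [IsNoetherianRing R] {I : Ideal R} (hI : I.radical = maximalIdeal R) :
    Module.length R (R ⧸ I) ≠ ⊤ := by
  have : IsArtinianRing (R ⧸ I) := by
    refine quotient_artinian_of_mem_minimalPrimes_of_isLocalRing I ⟨⟨inferInstance, ?_⟩, ?_⟩
    · exact hI ▸ Ideal.le_radical
    · rintro q ⟨hq, hIq⟩ -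
      exact hI ▸ hq.radical_le_iff.mpr hIq
  have : Module.length R (R ⧸ I) = Module.length (R ⧸ I) (R ⧸ I) :=
    Module.length_eq_of_surjective Ideal.Quotient.mk_surjective
  rw [this]
  exact Module.length_ne_top

theorem IsLocalRing.supportDim_quotient_le_zero_of_radical_eq {R : Type*} [CommRing R]
    [IsLocalRing R] {I : Ideal R} (hI : I.radical = maximalIdeal R) :
    Module.supportDim R (R ⧸ I) ≤ 0 := by
  rw [Module.supportDim_quotient_eq_ringKrullDim, ringKrullDim_quotient]
  have : Subsingleton (PrimeSpectrum.zeroLocus (R := R) I) := by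
    refine ⟨fun p q ↦ Subtype.ext (PrimeSpectrum.ext ?_)⟩
    have key (p : PrimeSpectrum.zeroLocus (R := R) I) : p.1.asIdeal = maximalIdeal R :=
      le_antisymm (le_maximalIdeal p.1.2.ne_top) (hI ▸ p.1.2.radical_le_iff.mpr p.2)
    rw [key, key]
  exact Order.krullDim_nonpos_of_subsingleton

theorem IsRegularLocalRing.exists_ofList_eq_maximalIdeal (R : Type*) [CommRing R]
    [IsRegularLocalRing R] :
    ∃ xs : List R, (xs.length : WithBot ℕ∞) = ringKrullDim R ∧
      Ideal.ofList xs = maximalIdeal R := by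
  obtain ⟨s, hcard, hs⟩ :=
    Submodule.FG.exists_span_finset_card_eq_spanFinrank (maximalIdeal R).fg_of_isNoetherianRing
  refine ⟨s.toList, ?_, ?_⟩
  · rw [Finset.length_toList, hcard, IsRegularLocalRing.spanFinrank_maximalIdeal]
  · rw [Ideal.ofList, ← hs]
    simp

/-- Regular local rings are Cohen–Macaulay: systems of parameters are regular sequences. -/
theorem IsRegularLocalRing.isWeaklyRegular_of_radical_eq {R : Type u} [CommRing R]
    [IsRegularLocalRing R] {ys : List R} (hlen : (ys.length : WithBot ℕ∞) = ringKrullDim R)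
    (hrad : (Ideal.ofList ys).radical = maximalIdeal R) : IsWeaklyRegular R ys := by
  obtain ⟨-, rs, hrl, hrm, hrs⟩ := isDomain_and_exists_isRegular ys.length R hlen.symm
  refine isWeaklyRegular_of_supportDim_quotient_le_zero hrm hrs (fun y hy ↦ ?_) hrl.symm ?_
  · exact hrad ▸ Ideal.le_radical (Ideal.subset_span hy)
  · refine supportDim_quotient_le_zero_of_radical_eq (I := Ideal.ofList ys • (⊤ : Ideal R)) ?_
    simpa using hrad

theorem IsRegularLocalRing.length_quotient_ofList_map_pow {R : Type*} [CommRing R]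
    [IsRegularLocalRing R] {ys : List R} (hlen : (ys.length : WithBot ℕ∞) = ringKrullDim R)
    (hrad : (Ideal.ofList ys).radical = maximalIdeal R) {n : ℕ} (hn : n ≠ 0) :
    Module.length R (R ⧸ Ideal.ofList (ys.map (· ^ n))) =
      n ^ ys.length * Module.length R (R ⧸ Ideal.ofList ys) := by
  have h := (isWeaklyRegular_of_radical_eq hlen hrad).length_quotient_ofList_map_pow
    (fun y hy ↦ hrad ▸ Ideal.le_radical (Ideal.subset_span hy)) hn
  have key (I : Ideal R) : Module.length R (R ⧸ I • (⊤ : Ideal R)) = Module.length R (R ⧸ I) :=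
    (Submodule.quotEquivOfEq _ _ (by simp)).length_eq
  rwa [key, key] at h

/-- The substitute for flatness of `f`: extending an `𝔪`-primary ideal along `f` multiplies its
colength by the length of `f`. -/
theorem IsRegularLocalRing.length_quotient_map {R S : Type*} [CommRing R] [IsRegularLocalRing R]
    [CommRing S] [IsRegularLocalRing S] (hdim : ringKrullDim R = ringKrullDim S) (f : R →+* S)
    (hf : ((maximalIdeal R).map f).radical = maximalIdeal S) {I : Ideal R}
    (hI : I.radical = maximalIdeal R) :
    Module.length S (S ⧸ I.map f) =
      Module.length S (S ⧸ (maximalIdeal R).map f) * Module.length R (R ⧸ I) := by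
  obtain ⟨xs, hlen, hxs⟩ := exists_ofList_eq_maximalIdeal R
  have hfxs : Ideal.ofList (xs.map f) = (maximalIdeal R).map f := by rw [← hxs, Ideal.map_ofList]
  have hradx : (Ideal.ofList xs).radical = maximalIdeal R := by
    rw [hxs]; exact (inferInstance : (maximalIdeal R).IsPrime).radical
  -- The ideal generated by `(k + 1)`-st powers of parameters lies in `I`; the exponent is not zero.
  obtain ⟨k, hk⟩ := Ideal.exists_radical_pow_le_of_fg I I.radical.fg_of_isNoetherianRing
  have hle : Ideal.ofList (xs.map (· ^ (k + 1))) ≤ I := by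
    refine Ideal.span_le.mpr fun y hy ↦ ?_
    obtain ⟨x, hx, rfl⟩ := List.mem_map.mp hy
    refine hk (Ideal.pow_le_pow_right k.le_succ (Ideal.pow_mem_pow ?_ _))
    rw [hI, ← hxs]
    exact Ideal.subset_span hx
  have h1 := length_quotient_ofList_map_pow hlen hradx k.succ_ne_zero
  have h2 := length_quotient_ofList_map_pow (ys := xs.map f) (by rw [List.length_map, hlen, hdim])
    (by rw [hfxs, hf]) k.succ_ne_zero
  have hmap : (xs.map f).map (· ^ (k + 1)) = (xs.map (· ^ (k + 1))).map f := by
    simp [Function.comp_def]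
  have hone : Module.length R (R ⧸ maximalIdeal R) = 1 :=
    Module.length_eq_one_iff.mpr (isSimpleModule_iff_isCoatom.mpr (maximalIdeal.isMaximal R).out)
  rw [hmap, ← Ideal.map_ofList, hfxs, List.length_map] at h2
  rw [hxs, hone, mul_one] at h1
  refine length_quotient_map_eq_of_le f hle (length_quotient_ne_top_of_radical_eq hf) ?_ ?_
  · rw [h1]
    exact WithTop.pow_ne_top (ENat.natCast_ne_top _)
  · rw [h1, h2, mul_comm]

/-! ### Multiplicativity of the length and the limits -/

namespace FiniteLengthMap

variable {R : Type*} [CommRing R]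

theorem IsOfFiniteLength.of_radical_eq [IsLocalRing R] {S : Type*} [CommRing S] [IsLocalRing S]
    {f : R →+* S} (hf : ((maximalIdeal R).map f).radical = maximalIdeal S) :
    IsOfFiniteLength f where
  isLocalHom := by
    refine ((local_hom_TFAE f).out 0 2).mpr ?_
    exact Ideal.le_radical.trans hf.le
  isPrimary := Ideal.isPrimary_of_isMaximal_radical (hf ▸ maximalIdeal.isMaximal S)
  radical_eq := hf

theorem map_pow_succ (φ : R →+* R) (I : Ideal R) (n : ℕ) :
    I.map (φ ^ (n + 1)) = (I.map (φ ^ n)).map φ := by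
  rw [pow_succ', Ideal.map_map]
  rfl

theorem IsOfFiniteLength.radical_map_pow [IsLocalRing R] [IsNoetherianRing R] {φ : R →+* R}
    (hφ : IsOfFiniteLength φ) (n : ℕ) :
    ((maximalIdeal R).map (φ ^ n)).radical = maximalIdeal R := by
  induction n with
  | zero =>
    rw [pow_zero, RingHom.one_def, Ideal.map_id]
    exact (inferInstance : (maximalIdeal R).IsPrime).radical
  | succ n ih =>
    rw [map_pow_succ]
    refine le_antisymm ?_ ?_
    · refine le_trans ?_ hφ.radical_eq.le
      exact Ideal.radical_mono (Ideal.map_mono (Ideal.le_radical.trans ih.le))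
    · obtain ⟨k, hk⟩ := Ideal.exists_radical_pow_le_of_fg ((maximalIdeal R).map (φ ^ n))
        (Ideal.fg_of_isNoetherianRing _)
      rw [ih] at hk
      have h1 := Ideal.map_mono (f := φ) hk
      rw [Ideal.map_pow] at h1
      refine hφ.radical_eq.ge.trans ((Ideal.radical_isRadical _).radical_le_iff.mpr fun x hx ↦ ?_)
      exact Ideal.mem_radical_iff.mpr ⟨k, h1 (Ideal.pow_mem_pow hx k)⟩

theorem IsOfFiniteLength.length_ne_top [IsLocalRing R] [IsNoetherianRing R] {φ : R →+* R}
    (hφ : IsOfFiniteLength φ) : length φ ≠ ⊤ :=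
  length_quotient_ne_top_of_radical_eq hφ.radical_eq

theorem IsOfFiniteLength.length_pos [IsLocalRing R] {φ : R →+* R} (hφ : IsOfFiniteLength φ) :
    0 < length φ := by
  refine Module.length_pos_iff.mpr (Ideal.Quotient.nontrivial_iff.mpr fun h ↦ ?_)
  have := hφ.radical_eq
  rw [h, Ideal.radical_top] at this
  exact (maximalIdeal.isMaximal R).ne_top this.symm

/-- Multiplicativity of the length, from which all the limits are read off. -/
theorem IsOfFiniteLength.length_pow [IsRegularLocalRing R] {φ : R →+* R}
    (hφ : IsOfFiniteLength φ) (n : ℕ) : length (φ ^ n) = length φ ^ n := by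
  induction n with
  | zero =>
    rw [pow_zero, pow_zero, length, RingHom.one_def, Ideal.map_id]
    exact Module.length_eq_one_iff.mpr
      (isSimpleModule_iff_isCoatom.mpr (maximalIdeal.isMaximal R).out)
  | succ n ih =>
    rw [length, map_pow_succ, IsRegularLocalRing.length_quotient_map rfl φ hφ.radical_eq
      (hφ.radical_map_pow n), pow_succ', ← ih]
    rfl

end FiniteLengthMap

open FiniteLengthMap

theorem corollary3p3 {R : Type*} [CommRing R] [IsRegularLocalRing R] (φ : R →+* R)
    (hφ : FiniteLengthMap.IsOfFiniteLength φ) :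
    (∀ n : ℕ, FiniteLengthMap.IsOfFiniteLength (φ ^ n) ∧ FiniteLengthMap.length (φ ^ n) ≠ ⊤) ∧
    Tendsto (fun n : ℕ => Real.log (FiniteLengthMap.lengthSeq φ n) / n) atTop
      (𝓝 (FiniteLengthMap.algEntropy φ)) ∧
    Tendsto (fun n : ℕ => FiniteLengthMap.lengthSeq φ n / FiniteLengthMap.q φ ^ n) atTop (𝓝 1) ∧
    FiniteLengthMap.hilbertKunz φ = 1 := by
  have hfin (n : ℕ) : IsOfFiniteLength (φ ^ n) := .of_radical_eq (hφ.radical_map_pow n)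
  have hpos : (0 : ℝ) < ((length φ).toNat : ℝ) := by
    exact_mod_cast Nat.pos_of_ne_zero fun h ↦
      (ENat.toNat_eq_zero.mp h).elim hφ.length_pos.ne' hφ.length_ne_top
  have hseq (n : ℕ) : lengthSeq φ n = ((length φ).toNat : ℝ) ^ n := by
    rw [lengthSeq, hφ.length_pow, ← Nat.cast_pow]
    exact congrArg _ (map_pow ENat.toNatHom (length φ) n)
  have hlim : Tendsto (fun n : ℕ ↦ Real.log (lengthSeq φ n) / n) atTop
      (𝓝 (Real.log ((length φ).toNat : ℝ))) := by
    refine tendsto_const_nhds.congr' ?_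
    -- At `n = 0` the quotient has the junk value `0`.
    filter_upwards [eventually_ne_atTop 0] with n hn
    rw [hseq, Real.log_pow]
    field_simp
  have hent : algEntropy φ = Real.log ((length φ).toNat : ℝ) := hlim.limUnder_eq
  have hq : q φ = ((length φ).toNat : ℝ) := by rw [q, hent, Real.exp_log hpos]
  have hHK : Tendsto (fun n : ℕ ↦ lengthSeq φ n / q φ ^ n) atTop (𝓝 1) := by
    refine tendsto_const_nhds.congr fun n ↦ ?_
    rw [hseq, hq, div_self (pow_pos hpos n).ne']
  exact ⟨fun n ↦ ⟨hfin n, (hfin n).length_ne_top⟩, hent ▸ hlim, hHK, hHK.limUnder_eq⟩
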